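/- Let $n\ge 2$. For $k\ge 1$ let $\Gamma_k\subset\mathbb C^k$ be the closed symmetrized polydisc, i.e. the set of points $(s_1,\dots,s_{k-1},p)$ with $s_i=\sum_{1\le l_1<\dots<l_i\le k}z_{l_1}\cdots z_{l_i}$ and $p=z_1\cdots z_k$ for some $z_1,\dots,z_k\in\mathbb C$, $|z_j|\le 1$. Let $(S_1,\dots,S_{n-1},P)$ be a pure $\Gamma_n$-contraction on a complex Hilbert space $\mathcal H$: the $S_i$ and $P$ are commuting bounded operators on $\mathcal H$, their Taylor joint spectrum is contained in $\Gamma_n$, $\|f(S_1,\dots,S_{n-1},P)\|\le\sup_{\Gamma_n}|f|$ for every complex polynomial $f$ in $n$ variables, and $P^{*k}\to 0$ strongly as $k\to\infty$. For a contraction $T$ put $D_T=(I-T^*T)^{1/2}$ and $\mathcal D_T=\overline{\operatorname{Ran}}\,D_T$. Let $$\Theta_P(z)=\left[-P+zD_{P^*}(I-zP^*)^{-1}D_P\right]\big|_{\mathcal D_P}\colon\mathcal D_P\to\mathcal D_{P^*}\qquad(|z|<1)$$ be the characteristic function of $P$, let $M_{\Theta_P}$ be the operator of multiplication by $\Theta_P$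 from $H^2(\mathbb D)\otimes\mathcal D_P$ to $H^2(\mathbb D)\otimes\mathcal D_{P^*}$ (Hilbert tensor products, regarded as spaces of vector-valued functions on the unit disc $\mathbb D$), and let $$\mathbb H_P=(H^2(\mathbb D)\otimes\mathcal D_{P^*})\ominus M_{\Theta_P}(H^2(\mathbb D)\otimes\mathcal D_P).$$ Let $P_{\mathbb H_P}$ denote the orthogonal projection of $H^2(\mathbb D)\otimes\mathcal D_{P^*}$ onto $\mathbb H_P$, and let $M_z$ denote multiplication by the coordinate function on $H^2(\mathbb D)$. Then there is exactly one tuple $(B_1,\dots,B_{n-1})$ of bounded operators on $\mathcal D_{P^*}$ with $$S_i^*-S_{n-i}P^*=D_{P^*}B_iD_{P^*}\qquad(i=1,\dots,n-1)$$ (the fundamental operator tuple of $(S_1^*,\dots,S_{n-1}^*,P^*)$), and there is a unitary $U\colon\mathcal H\to\mathbb H_P$ such that $$US_iU^*=P_{\mathbb H_P}(I\otimes B_i^*+M_z\otimes B_{n-i})\big|_{\mathbb H_P}\quad(i=1,\dots,n-1),\qquad UPU^*=P_{\mathbb H_P}(M_z\otimes I_{\mathcal D_{P^*}})\big|_{\mathbb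 H_P}.$$ -/

import Mathlib

open scoped TensorProduct

noncomputable section

namespace GammaModel

/-! ### The closed symmetrized polydisc and polynomial calculus -/

/-- The closed symmetrized polydisc `Γ_k`: the set of points `(s_1, …, s_{k-1}, p)` of `ℂ^k` given
by the elementary symmetric functions of some `z` in the closed unit polydisc. The coordinate with
index `j = 0, …, k - 1` is the elementary symmetric function of degree `j + 1`. -/
def symmetrizedPolydisc (k : ℕ) : Set (Fin k → ℂ) :=
  {x | ∃ z : Fin k → ℂ, (∀ i, ‖z i‖ ≤ 1) ∧
    ∀ j : Fin k, x j = ∑ t ∈ Finset.univ.powersetCard (j.val + 1), ∏ i ∈ t, z i}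

section Operators

variable {H : Type*} [NormedAddCommGroup H] [InnerProductSpace ℂ H]

/-- The value `f(T_1, …, T_k)` of a polynomial at a tuple of (commuting) operators:
`∑_d c_d T_1^{d_1} ⋯ T_k^{d_k}`. -/
def polyEval {k : ℕ} (f : MvPolynomial (Fin k) ℂ) (T : Fin k → H →L[ℂ] H) : H →L[ℂ] H :=
  ∑ d ∈ f.support, f.coeff d • (List.ofFn fun i => T i ^ d i).prod

/-! ### The Taylor joint spectrum -/

/-- The Koszul operator `D_T = ∑ T_i ⊗ E_i` on `H ⊗ Λ`, where `Λ` is the exterior algebra on `k`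
generators and `E_i ξ = e_i ∧ ξ`. -/
def koszul {k : ℕ} (T : Fin k → H →L[ℂ] H) :
    H ⊗[ℂ] ExteriorAlgebra ℂ (Fin k → ℂ) →ₗ[ℂ] H ⊗[ℂ] ExteriorAlgebra ℂ (Fin k → ℂ) :=
  ∑ i, TensorProduct.map (T i).toLinearMap
    (LinearMap.mulLeft ℂ (ExteriorAlgebra.ι ℂ (Pi.single i (1 : ℂ))))

/-- The Taylor joint spectrum of a (commuting) tuple: the `lam` for which the Koszul complex of
`T - lam` is not exact. -/
def taylorSpectrum {k : ℕ} (T : Fin k → H →L[ℂ] H) : Set (Fin k → ℂ) :=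
  {lam | LinearMap.range (koszul fun i => T i - lam i • (1 : H →L[ℂ] H)) ≠
    LinearMap.ker (koszul fun i => T i - lam i • (1 : H →L[ℂ] H))}

/-! ### `Γ_n`-contractions -/

/-- `(S_1, …, S_m, P)` is a `Γ_{m+1}`-contraction: a commuting tuple whose Taylor joint spectrum
lies in `Γ_{m+1}` and which satisfies the von Neumann inequality on `Γ_{m+1}` for all polynomials.
The operator `S_i` is `S` at the index `i - 1`. -/
structure IsGammaContraction {m : ℕ} (S : Fin m → H →L[ℂ] H) (P : H →L[ℂ] H) : Prop where
  commute_S : ∀ i j, Commute (S i) (S j)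
  commute_P : ∀ i, Commute (S i) P
  spectrum_subset :
    taylorSpectrum (Fin.snoc (α := fun _ => H →L[ℂ] H) S P) ⊆ symmetrizedPolydisc (m + 1)
  norm_le : ∀ f : MvPolynomial (Fin (m + 1)) ℂ,
    ‖polyEval f (Fin.snoc (α := fun _ => H →L[ℂ] H) S P)‖ ≤
      ⨆ x : symmetrizedPolydisc (m + 1), ‖MvPolynomial.eval x.1 f‖

variable [CompleteSpace H]

/-- A `Γ_{m+1}`-contraction is pure if `P^{*k} → 0` strongly. -/
structure IsPureGammaContraction {m : ℕ} (S : Fin m → H →L[ℂ] H) (P : H →L[ℂ] H) : Prop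
    extends IsGammaContraction S P where
  pure : ∀ h : H, Filter.Tendsto (fun k : ℕ => (ContinuousLinearMap.adjoint P ^ k) h)
    Filter.atTop (nhds 0)

/-! ### Defect operators and fundamental operator tuples -/

/-- The defect operator `D_T = (I - T^* T)^{1/2}` of a contraction. -/
def defect (T : H →L[ℂ] H) : H →L[ℂ] H :=
  CFC.sqrt (1 - ContinuousLinearMap.adjoint T * T)

/-- The defect space `𝓓_T`, the closure of the range of `D_T`. -/
abbrev defectSpace (T : H →L[ℂ] H) : Submodule ℂ H :=
  (LinearMap.range (defect T).toLinearMap).topologicalClosure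

/-- `D_T` as an operator from `H` to `𝓓_T`. -/
def defectTo (T : H →L[ℂ] H) : H →L[ℂ] defectSpace T :=
  (defect T).codRestrict (defectSpace T) fun h =>
    Submodule.le_topologicalClosure _ (LinearMap.mem_range_self (defect T).toLinearMap h)

/-- `(F_1, …, F_m)` is a fundamental operator tuple of `(S_1, …, S_m, P)`, where `m = n - 1`:
the `F_i` are bounded operators on `𝓓_P` with `S_i - S_{n-i}^* P = D_P F_i D_P`.
If `i` has the index `i - 1`, then `n - i` has the reversed index `Fin.rev (i - 1)`. -/
def IsFundamentalTuple {m : ℕ} (S : Fin m → H →L[ℂ] H) (P : H →L[ℂ] H)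
    (F : Fin m → defectSpace P →L[ℂ] defectSpace P) : Prop :=
  ∀ i, S i - ContinuousLinearMap.adjoint (S i.rev) * P =
    defect P ∘L (defectSpace P).subtypeL ∘L F i ∘L defectTo P

end Operators

/-! ### The vector-valued Hardy space `H²(𝔻) ⊗ E = H²(E)` -/

section Hardy

variable {E : Type*} [NormedAddCommGroup E] [InnerProductSpace ℂ E]

/-- The Hardy space `H²(𝔻) ⊗ E` of `E`-valued power series `∑ a_k z^k` with `∑ ‖a_k‖² < ∞`. Its
elements are given by their sequences of coefficients; `z^k ⊗ ξ` is the sequence with the entry `ξ`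
at `k` and `0` elsewhere. -/
abbrev Hardy (E : Type*) [NormedAddCommGroup E] [InnerProductSpace ℂ E] : Type _ :=
  lp (fun _ : ℕ => E) 2

/-- The value `f(z) = ∑ a_k z^k` of an element of the Hardy space at a point `z` of the disc. -/
def hardyEval (f : Hardy E) (z : ℂ) : E := ∑' k : ℕ, z ^ k • f k

theorem summable_hardyEval [CompleteSpace E] (f : Hardy E) {z : ℂ} (hz : ‖z‖ < 1) :
    Summable fun k : ℕ => z ^ k • f k := by
  refine Summable.of_norm_bounded
    ((summable_geometric_of_lt_one (norm_nonneg z) hz).mul_right ‖f‖) fun k => ?_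
  rw [norm_smul, norm_pow]
  exact mul_le_mul_of_nonneg_left (lp.norm_apply_le_norm two_ne_zero f k) (by positivity)

/-- `I ⊗ B` on the Hardy space: `∑ a_k z^k ↦ ∑ (B a_k) z^k`. -/
def hardyMap (B : E →L[ℂ] E) : Hardy E →L[ℂ] Hardy E :=
  lp.mapCLM 2 (fun _ : ℕ => B) (norm_nonneg B) fun _ => le_rfl

/-- The coefficient sequence `(0, a_0, a_1, …)`. -/
def shiftSeq (a : ℕ → E) : ℕ → E
  | 0 => 0
  | k + 1 => a k

theorem hasSum_shiftSeq (f : Hardy E) :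
    HasSum (fun k => ‖shiftSeq (f : ℕ → E) k‖ ^ (2 : ENNReal).toReal)
      (‖f‖ ^ (2 : ENNReal).toReal) := by
  have h := lp.hasSum_norm (p := 2) (by norm_num) f
  rw [← hasSum_nat_add_iff' 1]
  simpa [shiftSeq] using h

/-- `M_z ⊗ I` on the Hardy space: `∑ a_k z^k ↦ ∑ a_k z^{k+1}`. -/
def hardyShift : Hardy E →L[ℂ] Hardy E :=
  LinearMap.mkContinuous
    { toFun := fun f => ⟨shiftSeq (f : ℕ → E), memℓp_gen (hasSum_shiftSeq f).summable⟩
      map_add' := fun f g => by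
        ext k
        cases k
        · exact (add_zero (0 : E)).symm
        · rfl
      map_smul' := fun c f => by
        ext k
        cases k
        · exact (smul_zero c).symm
        · rfl }
    1 fun f => by
      rw [one_mul]
      exact lp.norm_le_of_tsum_le (by norm_num) (norm_nonneg f) (hasSum_shiftSeq f).tsum_eq.le

end Hardy

/-! ### The characteristic function and the model space -/

section Model

variable {H : Type*} [NormedAddCommGroup H] [InnerProductSpace ℂ H] [CompleteSpace H]

/-- The characteristic function
`Θ_P(z) = [-P + z D_{P^*} (I - z P^*)⁻¹ D_P]` restricted to `𝓓_P`. Its values lie in `𝓓_{P^*}`;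
here it is written as an operator from `𝓓_P` to `H`. -/
def charFun (P : H →L[ℂ] H) (z : ℂ) : defectSpace P →L[ℂ] H :=
  (-P + z • (defect (ContinuousLinearMap.adjoint P) *
      Ring.inverse (1 - z • ContinuousLinearMap.adjoint P) * defect P)) ∘L
    (defectSpace P).subtypeL

/-- The range `M_{Θ_P}(H²(𝔻) ⊗ 𝓓_P)` of multiplication by `Θ_P`: the `g` in `H²(𝔻) ⊗ 𝓓_{P^*}` such
that, for some `f` in `H²(𝔻) ⊗ 𝓓_P`, `g(z) = Θ_P(z) f(z)` on the open unit disc. -/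
def charRange (P : H →L[ℂ] H) :
    Submodule ℂ (Hardy (defectSpace (ContinuousLinearMap.adjoint P))) where
  carrier := {g | ∃ f : Hardy (defectSpace P), ∀ z : ℂ, ‖z‖ < 1 →
    ((hardyEval g z : defectSpace (ContinuousLinearMap.adjoint P)) : H) = charFun P z (hardyEval f z)}
  zero_mem' := ⟨0, fun z _ => by simp [hardyEval]⟩
  add_mem' := by
    rintro g₁ g₂ ⟨f₁, h₁⟩ ⟨f₂, h₂⟩
    refine ⟨f₁ + f₂, fun z hz => ?_⟩
    have hg : hardyEval (g₁ + g₂) z = hardyEval g₁ z + hardyEval g₂ z := by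
      simp only [hardyEval, lp.coeFn_add, Pi.add_apply, smul_add]
      exact (summable_hardyEval g₁ hz).tsum_add (summable_hardyEval g₂ hz)
    have hf : hardyEval (f₁ + f₂) z = hardyEval f₁ z + hardyEval f₂ z := by
      simp only [hardyEval, lp.coeFn_add, Pi.add_apply, smul_add]
      exact (summable_hardyEval f₁ hz).tsum_add (summable_hardyEval f₂ hz)
    rw [hg, hf, map_add, Submodule.coe_add, h₁ z hz, h₂ z hz]
  smul_mem' := by
    rintro c g ⟨f, h⟩
    refine ⟨c • f, fun z hz => ?_⟩
    have hg : hardyEval (c • g) z = c • hardyEval g z := by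
      simp only [hardyEval, lp.coeFn_smul, Pi.smul_apply, smul_comm _ c]
      exact (summable_hardyEval g hz).tsum_const_smul c
    have hf : hardyEval (c • f) z = c • hardyEval f z := by
      simp only [hardyEval, lp.coeFn_smul, Pi.smul_apply, smul_comm _ c]
      exact (summable_hardyEval f hz).tsum_const_smul c
    rw [hg, hf, map_smul, Submodule.coe_smul, h z hz]

/-- The model space `ℍ_P = (H²(𝔻) ⊗ 𝓓_{P^*}) ⊖ M_{Θ_P}(H²(𝔻) ⊗ 𝓓_P)`. -/
abbrev modelSpace (P : H →L[ℂ] H) :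
    Submodule ℂ (Hardy (defectSpace (ContinuousLinearMap.adjoint P))) :=
  (charRange P)ᗮ

/-- The compression of an operator `T` on `H²(𝔻) ⊗ 𝓓_{P^*}` to the model space: `T` restricted to
`ℍ_P`, followed by the orthogonal projection onto `ℍ_P`. -/
def compression (P : H →L[ℂ] H)
    (T : Hardy (defectSpace (ContinuousLinearMap.adjoint P)) →L[ℂ]
      Hardy (defectSpace (ContinuousLinearMap.adjoint P))) :
    modelSpace P →L[ℂ] modelSpace P :=
  (modelSpace P).orthogonalProjectionOnto ∘L T ∘L (modelSpace P).subtypeL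

end Model

end GammaModel

end

/-!
The proof has two independent halves: the fundamental operators come from a scalar inequality on the
polydisc, and the model is the Sz.-Nagy–Foias model of the pure contraction `P`.

**Fundamental operators.** Write `k = n.choose i`. On the torus the elementary symmetric functions
satisfy `e_i = conj (e_{n-i}) p`, so the rational function `k (e_i - w k p) / (k - w e_{n-i})` is
bounded by `k` there, and by the maximum principle on the whole polydisc (`norm_elemSymm_sub_le`).
The von Neumann inequality, applied to the partial sums of the geometric series, turns this into
`‖(S_i - w k P)^* g‖ ≤ ‖(k - w S_{n-i})^* g‖` for `‖w‖ < 1`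
(`IsGammaContraction.norm_adjoint_sub_apply_le`). Squaring, letting `‖w‖ → 1`, adding the same
inequality with `i` and `n - i` exchanged, and averaging over `w` gives
`|⟪g, (S_i^* - S_{n-i} P^*) g⟫| ≤ k ‖D_{P^*} g‖²`. By polarization and two applications of Douglas'
factorization, `S_i^* - S_{n-i} P^*` is of the form `D_{P^*} B_i D_{P^*}`. Uniqueness holds because
`D_{P^*}` maps onto a dense subspace of the defect space and is injective on it.

**The model.** Since `P` is pure, `W h = ∑ z^k D_{P^*} P^{*k} h` is an isometry (`modelEmbedding`).
Multiplication by `Θ_P` is the input-output map of the linear system `u_{k+1} = P^* u_k + D_P f_k`,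
`g_k = D_{P^*} u_k - P f_k` with `u_0 = 0` (`mem_charRange_iff`), whose operator matrix is unitary
by `P D_P = D_{P^*} P`. Energy conservation shows that its outputs are orthogonal to the range of
`W`, and running the system backwards writes each `z^n ⊗ ξ` as the sum of an element of the range of
`W` and an output (`single_sub_modelEmbedding_mem_charRange`). Hence `W` maps onto the model space.

**The compressions.** The identity `D_{P^*} S_i^* = B_i D_{P^*} + B_{n-i}^* D_{P^*} P^*`, checked by
multiplying with `D_{P^*}` from the left, says that `W S_i^* = (I ⊗ B_i^* + M_z ⊗ B_{n-i})^* W`;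
likewise `W P^* = M_z^* W`. Taking adjoints and compressing to the range of `W` gives the theorem.
-/

noncomputable section

namespace GammaModel

/-! ### Elementary symmetric functions on the closed polydisc -/

/-- The elementary symmetric function of degree `d` as a function on `ι → ℂ`. -/
def elemSymm {ι : Type*} [Fintype ι] (d : ℕ) (z : ι → ℂ) : ℂ :=
  ∑ t ∈ Finset.univ.powersetCard d, ∏ i ∈ t, z i

section Scalar

variable {ι : Type*} [Fintype ι]

theorem norm_elemSymm_le {d : ℕ} {z : ι → ℂ} (hz : ∀ i, ‖z i‖ ≤ 1) :
    ‖elemSymm d z‖ ≤ (Fintype.card ι).choose d := by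
  calc ‖elemSymm d z‖ ≤ ∑ t ∈ (Finset.univ : Finset ι).powersetCard d, 1 := by
        refine norm_sum_le_of_le _ fun t _ => ?_
        rw [norm_prod]
        exact Finset.prod_le_one (fun _ _ => norm_nonneg _) fun i _ => hz i
    _ = (Fintype.card ι).choose d := by simp

/-- On the torus, inversion of the coordinates is complex conjugation. -/
theorem elemSymm_eq_star_mul_prod {d e : ℕ} (hde : d + e = Fintype.card ι) {z : ι → ℂ}
    (hz : ∀ i, ‖z i‖ = 1) : elemSymm d z = star (elemSymm e z) * ∏ i, z i := by
  classical
  rw [elemSymm, elemSymm, star_sum, Finset.sum_mul]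
  refine Finset.sum_bij' (fun t _ => tᶜ) (fun t _ => tᶜ) ?_ ?_ ?_ ?_ ?_
  · intro t ht
    simp only [Finset.mem_powersetCard, Finset.subset_univ, true_and, Finset.card_compl] at ht ⊢
    omega
  · intro t ht
    simp only [Finset.mem_powersetCard, Finset.subset_univ, true_and, Finset.card_compl] at ht ⊢
    omega
  · simp
  · simp
  · intro t _
    rw [← Finset.prod_mul_prod_compl t, mul_left_comm, star_prod, ← Finset.prod_mul_distrib,
      Finset.prod_eq_one (s := tᶜ), mul_one]
    intro i _
    rw [← starRingEnd_apply, Complex.conj_mul', hz i]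
    simp

theorem differentiable_prod_update {ι : Type*} [DecidableEq ι] (t : Finset ι) (z : ι → ℂ) (i : ι) :
    Differentiable ℂ fun ζ : ℂ => ∏ j ∈ t, Function.update z i ζ j := by
  refine Differentiable.fun_finsetProd fun j _ => ?_
  by_cases h : j = i
  · subst h; simp
  · simp [h]

theorem differentiable_elemSymm_update [DecidableEq ι] (d : ℕ) (z : ι → ℂ) (i : ι) :
    Differentiable ℂ fun ζ : ℂ => elemSymm d (Function.update z i ζ) := by
  unfold elemSymm
  exact Differentiable.fun_sum fun t _ => differentiable_prod_update t z i

/-- Contractivity of a Möbius map: the difference of the squares of the two sides is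
`(1 - ‖w‖²) (k² - ‖s‖²)`. -/
theorem norm_star_sub_le {k : ℝ} {s w : ℂ} (hs : ‖s‖ ≤ k) (hw : ‖w‖ ≤ 1) :
    ‖star s - w * k‖ ≤ ‖k - w * s‖ := by
  have hk : 0 ≤ k := (norm_nonneg s).trans hs
  refine le_of_sq_le_sq ?_ (norm_nonneg _)
  have h1 : ‖s‖ ^ 2 ≤ k ^ 2 := by gcongr
  have h2 : ‖w‖ ^ 2 ≤ 1 := pow_le_one₀ (norm_nonneg _) hw
  rw [Complex.sq_norm, Complex.normSq_apply] at h1 h2 ⊢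
  rw [Complex.sq_norm, Complex.normSq_apply]
  simp
  nlinarith [mul_nonneg (sub_nonneg.2 h1) (sub_nonneg.2 h2)]

/-- The scalar inequality behind the fundamental operators: the rational function
`(e_d - w k p) / (k - w e_{n-d})`, with `k = n.choose d`, is bounded by `1` on the polydisc. The
bound on the torus propagates inside by the maximum principle in one coordinate at a time. -/
theorem norm_elemSymm_sub_le {d e : ℕ} (hde : d + e = Fintype.card ι) {w : ℂ} (hw : ‖w‖ < 1)
    {z : ι → ℂ} (hz : ∀ i, ‖z i‖ ≤ 1) :
    ‖elemSymm d z - w * (Fintype.card ι).choose d * ∏ i, z i‖ ≤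
      ‖(Fintype.card ι).choose d - w * elemSymm e z‖ := by
  classical
  set k : ℕ := (Fintype.card ι).choose d with hk
  have hke : (Fintype.card ι).choose e = k := by
    rw [hk, ← hde]; exact (Nat.choose_symm_add).symm
  have hkpos : 0 < (k : ℝ) := by
    rw [hk]; exact_mod_cast Nat.choose_pos (by omega)
  have hden : ∀ y : ι → ℂ, (∀ i, ‖y i‖ ≤ 1) → (k : ℂ) - w * elemSymm e y ≠ 0 := by
    intro y hy h0
    have h1 : ‖(k : ℂ)‖ = ‖w‖ * ‖elemSymm e y‖ := by rw [sub_eq_zero.1 h0, norm_mul]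
    rw [Complex.norm_natCast] at h1
    have h2 := norm_elemSymm_le (d := e) hy
    rw [hke] at h2
    nlinarith [norm_nonneg w]
  -- Induction on a set `s` of coordinates off which the point lies on the unit circle.
  suffices h : ∀ (s : Finset ι) (y : ι → ℂ), (∀ i, ‖y i‖ ≤ 1) → (∀ i ∉ s, ‖y i‖ = 1) →
      ‖elemSymm d y - w * k * ∏ i, y i‖ ≤ ‖(k : ℂ) - w * elemSymm e y‖ from
    h Finset.univ z hz (by simp)
  intro s
  induction s using Finset.induction_on with
  | empty =>
    intro y _ hy
    have hy1 : ∀ i, ‖y i‖ = 1 := fun i => hy i (by simp)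
    have hp : ‖∏ i, y i‖ = 1 := by rw [norm_prod]; exact Finset.prod_eq_one fun i _ => hy1 i
    rw [elemSymm_eq_star_mul_prod hde hy1, ← sub_mul, norm_mul, hp, mul_one]
    have h2 := norm_elemSymm_le (d := e) fun i => (hy1 i).le
    rw [hke] at h2
    simpa using norm_star_sub_le h2 hw.le
  | insert i s _ ih =>
    intro y hy hys
    have hup : ∀ ζ : ℂ, ‖ζ‖ ≤ 1 → ∀ j, ‖Function.update y i ζ j‖ ≤ 1 := by
      intro ζ hζ j
      by_cases hj : j = i
      · subst hj; simpa using hζ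
      · simpa [hj] using hy j
    set F : ℂ → ℂ := fun ζ => (elemSymm d (Function.update y i ζ) -
      w * k * ∏ j, Function.update y i ζ j) / (k - w * elemSymm e (Function.update y i ζ)) with hF
    have hd1 := differentiable_elemSymm_update d y i
    have hd2 := differentiable_elemSymm_update e y i
    have hd3 := differentiable_prod_update Finset.univ y i
    have hFd : DiffContOnCl ℂ F (Metric.ball 0 1) := by
      refine DifferentiableOn.diffContOnCl fun ζ hζ => ?_
      rw [closure_ball _ one_ne_zero, mem_closedBall_zero_iff] at hζ
      exact (((hd1 ζ).sub ((hd3 ζ).const_mul _)).fun_div (((hd2 ζ).const_mul _).const_sub _)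
        (hden _ (hup ζ hζ))).differentiableWithinAt
    have hmax := Complex.norm_le_of_forall_mem_frontier_norm_le Metric.isBounded_ball hFd
      (C := 1) (z := y i) (fun ζ hζ => ?_) ?_
    · simp only [hF, Function.update_eq_self, norm_div] at hmax
      rwa [div_le_one (norm_pos_iff.2 (hden y hy))] at hmax
    · rw [frontier_ball _ one_ne_zero, mem_sphere_zero_iff_norm] at hζ
      rw [hF, norm_div, div_le_one (norm_pos_iff.2 (hden _ (hup ζ hζ.le)))]
      refine ih _ (hup ζ hζ.le) fun j hj => ?_
      by_cases hji : j = i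
      · subst hji; simpa using hζ
      · simpa [hji] using hys j (by simp [hji, hj])
    · rw [closure_ball _ one_ne_zero, mem_closedBall_zero_iff]
      exact hy i

/-- The polynomial `(e_d - w k p) ∑_{l < N} (w k⁻¹ e_{n-d})^l`, a partial sum of the expansion of
`k (e_d - w k p) / (k - w e_{n-d})`, is bounded by `k (1 + ‖w‖^N)`. -/
theorem norm_elemSymm_sub_mul_sum_le {d e : ℕ} (hde : d + e = Fintype.card ι) {w : ℂ}
    (hw : ‖w‖ < 1) {z : ι → ℂ} (hz : ∀ i, ‖z i‖ ≤ 1) {k : ℂ}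
    (hk : k = (Fintype.card ι).choose d) (N : ℕ) :
    ‖(elemSymm d z - w * k * ∏ i, z i) *
        ∑ l ∈ Finset.range N, (w * k⁻¹ * elemSymm e z) ^ l‖ ≤ ‖k‖ * (1 + ‖w‖ ^ N) := by
  have hk0 : k ≠ 0 := by
    rw [hk]; exact_mod_cast (Nat.choose_pos (by omega)).ne'
  have hke : (Fintype.card ι).choose e = (Fintype.card ι).choose d := by
    rw [← hde]; exact (Nat.choose_symm_add).symm
  set x : ℂ := w * k⁻¹ * elemSymm e z with hx
  have hxw : ‖x‖ ≤ ‖w‖ := by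
    have h2 := norm_elemSymm_le (d := e) hz
    rw [hke, ← Complex.norm_natCast, ← hk] at h2
    rw [hx, norm_mul, norm_mul, norm_inv, mul_assoc]
    refine mul_le_of_le_one_right (norm_nonneg _) ?_
    rwa [inv_mul_le_iff₀ (norm_pos_iff.2 hk0), mul_one]
  have h1 := norm_elemSymm_sub_le hde hw hz
  rw [← hk] at h1
  have h3 : k - w * elemSymm e z = k * (1 - x) := by rw [hx]; field_simp
  calc ‖(elemSymm d z - w * k * ∏ i, z i) * ∑ l ∈ Finset.range N, x ^ l‖
      ≤ ‖k - w * elemSymm e z‖ * ‖∑ l ∈ Finset.range N, x ^ l‖ := by rw [norm_mul]; gcongr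
    _ = ‖k‖ * ‖1 - x ^ N‖ := by rw [h3, ← norm_mul, mul_assoc, mul_neg_geom_sum, norm_mul]
    _ ≤ ‖k‖ * (1 + ‖w‖ ^ N) := by
        gcongr
        refine (norm_sub_le _ _).trans ?_
        rw [norm_one, norm_pow]
        gcongr

end Scalar

/-! ### The polynomial calculus of a commuting tuple -/

section Calculus

variable {H : Type*} [NormedAddCommGroup H] [InnerProductSpace ℂ H]

open scoped IsMulCommutative in
/-- For a commuting tuple, evaluation of polynomials is an algebra homomorphism. -/
theorem exists_algHom_polyEval {k : ℕ} (T : Fin k → H →L[ℂ] H) (hT : ∀ i j, Commute (T i) (T j)) :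
    ∃ φ : MvPolynomial (Fin k) ℂ →ₐ[ℂ] (H →L[ℂ] H),
      (∀ i, φ (MvPolynomial.X i) = T i) ∧ ∀ f, polyEval f T = φ f := by
  have hcomm : ∀ a ∈ Set.range T, ∀ b ∈ Set.range T, a * b = b * a := by
    rintro _ ⟨i, rfl⟩ _ ⟨j, rfl⟩; exact hT i j
  have := Algebra.isMulCommutative_adjoin ℂ hcomm
  let T' : Fin k → Algebra.adjoin ℂ (Set.range T) :=
    fun i => ⟨T i, Algebra.subset_adjoin (Set.mem_range_self i)⟩
  have hval : ∀ d : Fin k →₀ ℕ, ((∏ i, T' i ^ d i : Algebra.adjoin ℂ (Set.range T)) : H →L[ℂ] H) =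
      (List.ofFn fun i => T i ^ d i).prod := by
    intro d
    rw [← List.prod_ofFn]
    change (Algebra.adjoin ℂ (Set.range T)).val _ = _
    rw [map_list_prod, List.map_ofFn]
    rfl
  refine ⟨(Algebra.adjoin ℂ (Set.range T)).val.comp (MvPolynomial.aeval T'), fun i => ?_,
    fun f => ?_⟩
  · simp [T']
  · rw [AlgHom.comp_apply, MvPolynomial.aeval_def, MvPolynomial.eval₂_eq', map_sum, polyEval]
    refine Finset.sum_congr rfl fun d _ => ?_
    rw [map_mul, Subalgebra.coe_val, hval, Subalgebra.coe_algebraMap, Algebra.smul_def]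

variable {m : ℕ} {S : Fin m → H →L[ℂ] H} {P : H →L[ℂ] H}

/-- The von Neumann inequality, for the polynomial calculus as an algebra homomorphism. -/
theorem IsGammaContraction.exists_algHom (h : IsGammaContraction S P) :
    ∃ φ : MvPolynomial (Fin (m + 1)) ℂ →ₐ[ℂ] (H →L[ℂ] H),
      (∀ i, φ (MvPolynomial.X (Fin.castSucc i)) = S i) ∧ φ (MvPolynomial.X (Fin.last m)) = P ∧
      ∀ f (C : ℝ), 0 ≤ C → (∀ x ∈ symmetrizedPolydisc (m + 1), ‖MvPolynomial.eval x f‖ ≤ C) →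
        ‖φ f‖ ≤ C := by
  obtain ⟨φ, hX, hφ⟩ := exists_algHom_polyEval
    (Fin.snoc (α := fun _ => H →L[ℂ] H) S P) (by
      intro i j
      induction i using Fin.lastCases with
      | last =>
        induction j using Fin.lastCases with
        | last => exact Commute.refl _
        | cast j => simpa using (h.commute_P j).symm
      | cast i =>
        induction j using Fin.lastCases with
        | last => simpa using h.commute_P i
        | cast j => simpa using h.commute_S i j)
  refine ⟨φ, fun i => by simp [hX], by simp [hX], fun f C hC hf => ?_⟩
  rw [← hφ]
  exact (h.norm_le f).trans (Real.iSup_le (fun x => hf x.1 x.2) hC)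

theorem exists_elemSymm_of_mem_symmetrizedPolydisc {x : Fin (m + 1) → ℂ}
    (hx : x ∈ symmetrizedPolydisc (m + 1)) :
    ∃ z : Fin (m + 1) → ℂ, (∀ i, ‖z i‖ ≤ 1) ∧
      (∀ i : Fin m, x i.castSucc = elemSymm (i.val + 1) z) ∧ x (Fin.last m) = ∏ i, z i := by
  obtain ⟨z, hz, hx⟩ := hx
  refine ⟨z, hz, fun i => by rw [hx]; rfl, ?_⟩
  rw [hx, Fin.val_last]
  have h : (Finset.univ : Finset (Fin (m + 1))).powersetCard (m + 1) = {Finset.univ} := by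
    simpa using Finset.powersetCard_self (Finset.univ : Finset (Fin (m + 1)))
  rw [h, Finset.sum_singleton]

theorem IsGammaContraction.norm_P_le (h : IsGammaContraction S P) : ‖P‖ ≤ 1 := by
  obtain ⟨φ, -, hP, hφ⟩ := h.exists_algHom
  rw [← hP]
  refine hφ _ 1 zero_le_one fun x hx => ?_
  obtain ⟨z, hz, -, hx⟩ := exists_elemSymm_of_mem_symmetrizedPolydisc hx
  rw [MvPolynomial.eval_X, hx, norm_prod]
  exact Finset.prod_le_one (fun _ _ => norm_nonneg _) fun i _ => hz i

theorem IsGammaContraction.norm_S_le (h : IsGammaContraction S P) (i : Fin m) :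
    ‖S i‖ ≤ (m + 1).choose (i.val + 1) := by
  obtain ⟨φ, hS, -, hφ⟩ := h.exists_algHom
  rw [← hS]
  refine hφ _ _ (by positivity) fun x hx => ?_
  obtain ⟨z, hz, hx, -⟩ := exists_elemSymm_of_mem_symmetrizedPolydisc hx
  rw [MvPolynomial.eval_X, hx]
  simpa using norm_elemSymm_le (d := i.val + 1) hz

variable [CompleteSpace H]

open ContinuousLinearMap in
/-- The operator version of `norm_elemSymm_sub_le`, for the adjoint tuple: the operator
`(S_i - w k P) (k - w S_{n-i})⁻¹` is a contraction. It is written without the inverse, as a limit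
of the von Neumann inequality for the partial sums of the geometric series. -/
theorem IsGammaContraction.norm_adjoint_sub_apply_le (h : IsGammaContraction S P) (i : Fin m)
    {w : ℂ} (hw : ‖w‖ < 1) (g : H) :
    ‖adjoint (S i - (w * (m + 1).choose (i.val + 1)) • P) g‖ ≤
      ‖adjoint (((m + 1).choose (i.val + 1) : ℂ) • (1 : H →L[ℂ] H) - w • S i.rev) g‖ := by
  obtain ⟨φ, hS, hP, hφ⟩ := h.exists_algHom
  have hde : (i.val + 1) + (i.rev.val + 1) = Fintype.card (Fin (m + 1)) := by
    rw [Fin.val_rev, Fintype.card_fin]; omega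
  have hrev : (m + 1).choose (i.rev.val + 1) = (m + 1).choose (i.val + 1) := by
    rw [Fintype.card_fin] at hde
    rw [← hde]; exact (Nat.choose_symm_add).symm
  have hSr := h.norm_S_le i.rev
  rw [hrev] at hSr
  obtain ⟨k, hk⟩ : ∃ k : ℂ, k = (m + 1).choose (i.val + 1) := ⟨_, rfl⟩
  have hk0 : k ≠ 0 := by
    rw [hk]; exact_mod_cast (Nat.choose_pos (by omega)).ne'
  rw [← Complex.norm_natCast, ← hk] at hSr
  rw [← hk]
  -- `A` and `1 - Y` are the numerator and the normalized denominator.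
  set A : H →L[ℂ] H := S i - (w * k) • P with hA
  set Y : H →L[ℂ] H := (w * k⁻¹) • S i.rev with hY
  have hYw : ‖Y‖ ≤ ‖w‖ := by
    rw [hY, norm_smul, norm_mul, norm_inv, mul_assoc]
    refine mul_le_of_le_one_right (norm_nonneg _) ?_
    rwa [inv_mul_le_iff₀ (norm_pos_iff.2 hk0), mul_one]
  have hcomm : Commute A Y :=
    ((h.commute_S i i.rev).sub_left ((h.commute_P i.rev).symm.smul_left _)).smul_right _
  have hR : ∀ N : ℕ, ‖A * ∑ l ∈ Finset.range N, Y ^ l‖ ≤ ‖k‖ * (1 + ‖w‖ ^ N) := by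
    intro N
    have := hφ ((MvPolynomial.X i.castSucc - MvPolynomial.C (w * k) * MvPolynomial.X (Fin.last m)) *
      ∑ l ∈ Finset.range N, (MvPolynomial.C (w * k⁻¹) * MvPolynomial.X i.rev.castSucc) ^ l)
      (‖k‖ * (1 + ‖w‖ ^ N)) (by positivity) (fun x hx => ?_)
    · simpa only [map_mul φ, map_sub, map_sum, map_pow, hS, hP, ← MvPolynomial.algebraMap_eq,
        ← Algebra.smul_def, map_smul, ← hA, ← hY] using this
    · obtain ⟨z, hz, hx1, hx2⟩ := exists_elemSymm_of_mem_symmetrizedPolydisc hx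
      simp only [map_mul, map_sub, map_sum, map_pow, MvPolynomial.eval_X, MvPolynomial.eval_C,
        hx1, hx2]
      exact norm_elemSymm_sub_mul_sum_le hde hw hz (by rw [hk, Fintype.card_fin]) N
  have hden : k • (1 : H →L[ℂ] H) - w • S i.rev = k • (1 - Y) := by
    rw [smul_sub, hY, smul_smul, mul_left_comm, mul_inv_cancel₀ hk0, mul_one]
  have hden' : ∀ g, adjoint (k • (1 - Y)) g = star k • adjoint (1 - Y) g := by
    intro g; rw [← star_eq_adjoint, star_smul]; rfl
  have hN : ∀ N : ℕ, ‖adjoint A g - adjoint (A * Y ^ N) g‖ ≤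
      ‖k‖ * (1 + ‖w‖ ^ N) * ‖adjoint (1 - Y) g‖ := by
    intro N
    have h1 : A - A * Y ^ N = (1 - Y) * (A * ∑ l ∈ Finset.range N, Y ^ l) := by
      have : Commute A (1 - Y) := (Commute.one_right A).sub_right hcomm
      rw [← mul_assoc, ← this.eq, mul_assoc, mul_neg_geom_sum, mul_sub, mul_one]
    rw [← sub_apply, ← map_sub, h1, ← star_eq_adjoint, star_mul]
    change ‖star (A * ∑ l ∈ Finset.range N, Y ^ l) (star (1 - Y) g)‖ ≤ _
    refine (le_opNorm _ _).trans ?_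
    rw [norm_star]
    gcongr
    · exact hR N
    · exact le_rfl
  have hlim0 : Filter.Tendsto (fun N : ℕ => ‖w‖ ^ N) Filter.atTop (nhds 0) :=
    tendsto_pow_atTop_nhds_zero_of_lt_one (norm_nonneg _) hw
  have hlim1 : Filter.Tendsto (fun N : ℕ => adjoint (A * Y ^ N) g) Filter.atTop (nhds 0) := by
    refine squeeze_zero_norm (a := fun N => ‖A‖ * ‖w‖ ^ N * ‖g‖) (fun N => ?_) ?_
    · refine (le_opNorm _ _).trans ?_
      rw [← star_eq_adjoint, norm_star]
      gcongr
      induction N with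
      | zero => simp
      | succ N ih =>
        rw [pow_succ, ← mul_assoc, pow_succ, ← mul_assoc]
        exact (norm_mul_le _ _).trans (by gcongr)
    · simpa using (hlim0.const_mul ‖A‖).mul_const ‖g‖
  have hfin := le_of_tendsto_of_tendsto ((tendsto_const_nhds.sub hlim1).norm)
    (((tendsto_const_nhds.add hlim0).const_mul ‖k‖).mul_const ‖adjoint (1 - Y) g‖)
    (Filter.Eventually.of_forall hN)
  rw [hden, hden', norm_smul, norm_star]
  simpa using hfin

end Calculus

/-! ### Defect operators -/

section Defect

open ContinuousLinearMap

variable {H : Type*} [NormedAddCommGroup H] [InnerProductSpace ℂ H] [CompleteSpace H]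
  {T : H →L[ℂ] H}

theorem defect_nonneg (T : H →L[ℂ] H) : 0 ≤ defect T := CFC.sqrt_nonneg _

theorem adjoint_defect (T : H →L[ℂ] H) : adjoint (defect T) = defect T :=
  (defect_nonneg T).isSelfAdjoint

theorem defect_mul_self (hT : ‖T‖ ≤ 1) : defect T * defect T = 1 - adjoint T * T := by
  refine CFC.sqrt_mul_sqrt_self _ ?_
  rw [sub_nonneg]
  exact (CStarAlgebra.norm_le_one_iff_of_nonneg _ (star_mul_self_nonneg T)).1
    ((norm_mul_le _ _).trans (by rw [norm_star]; exact mul_le_one₀ hT (norm_nonneg _) hT))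

theorem defect_defect_apply (hT : ‖T‖ ≤ 1) (h : H) :
    defect T (defect T h) = h - adjoint T (T h) := by
  simpa using congr($(defect_mul_self hT) h)

theorem norm_defect_apply_sq (hT : ‖T‖ ≤ 1) (h : H) :
    ‖defect T h‖ ^ 2 = ‖h‖ ^ 2 - ‖T h‖ ^ 2 := by
  have h1 : inner ℂ (defect T h) (defect T h) = inner ℂ h h - inner ℂ (T h) (T h) := by
    rw [← adjoint_inner_right, adjoint_defect, defect_defect_apply hT, inner_sub_right,
      adjoint_inner_right]
  simp only [inner_self_eq_norm_sq_to_K] at h1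
  exact_mod_cast h1

/-- `T D_T = D_{T^*} T`. The difference `X` of the two sides satisfies `D_{T^*} X + X D_T = 0`;
multiplied by `X^*`, this makes the positive operators `X^* D_{T^*} X` and `X^* X D_T` cancel, so
both vanish. Hence `X D_T` and `D_{T^*} X` vanish, and with them `(X^* X)²`. -/
theorem mul_defect (hT : ‖T‖ ≤ 1) : T * defect T = defect (adjoint T) * T := by
  have hT' : ‖adjoint T‖ ≤ 1 := by rwa [← star_eq_adjoint, norm_star]
  have hD := defect_mul_self hT
  have hL := defect_mul_self hT'
  rw [adjoint_adjoint] at hL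
  have hD0 := defect_nonneg T
  have hL0 := defect_nonneg (adjoint T)
  set D := defect T
  set L := defect (adjoint T)
  have hDs : star D = D := hD0.isSelfAdjoint
  have hLs : star L = L := hL0.isSelfAdjoint
  simp only [← star_eq_adjoint] at hD hL
  rw [← sub_eq_zero]
  set X := T * D - L * T with hX
  have h1 : L * X + X * D = 0 := by
    have : L * X + X * D = T * (D * D) - L * L * T := by rw [hX]; noncomm_ring
    rw [this, hD, hL]; noncomm_ring
  have h1' : X * D = -(L * X) := by rw [eq_neg_iff_add_eq_zero, add_comm, h1]
  have h2 : star X * X * D = -(star X * L * X) := by rw [mul_assoc, h1']; noncomm_ring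
  have hpos : 0 ≤ star X * L * X := star_left_conjugate_nonneg hL0 X
  have hcomm : Commute (star X * X) D := by
    have h3 := congr(star $h2)
    simp only [star_mul, star_neg, star_star, hDs, hLs] at h3
    rw [Commute, SemiconjBy, h2, h3, mul_assoc]
  have hpos' : 0 ≤ star X * X * D := hcomm.mul_nonneg (star_mul_self_nonneg X) hD0
  have h4 : star X * X * D = 0 := by
    refine le_antisymm ?_ hpos'
    rw [h2]; exact neg_nonpos.2 hpos
  have h5 : X * D = 0 := by
    rw [← CStarRing.star_mul_self_eq_zero_iff, star_mul, hDs, mul_assoc, ← mul_assoc (star X), h4,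
      mul_zero]
  have h6 : L * X = 0 := by rwa [h5, add_zero] at h1
  have h7 : star X * L = 0 := by
    have := congr(star $h6); rwa [star_mul, hLs, star_zero] at this
  have h8 : star X * X = star X * T * D := by
    rw [hX, mul_sub, ← hX, ← mul_assoc, ← mul_assoc, h7, zero_mul, sub_zero]
  have h9 : (star X * X) * (star X * X) = 0 := by
    have h10 : star X * X = D * (star T * X) := by
      have := congr(star $h8)
      simpa only [star_mul, star_star, hDs] using this
    nth_rw 2 [h10]
    rw [← mul_assoc, h4, zero_mul]
  rw [← CStarRing.star_mul_self_eq_zero_iff, ← CStarRing.star_mul_self_eq_zero_iff, star_mul,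
    star_star]
  exact h9

theorem map_mem_defectSpace (hT : ‖T‖ ≤ 1) {x : H} (hx : x ∈ defectSpace T) :
    T x ∈ defectSpace (adjoint T) := by
  have hmaps : Set.MapsTo T (LinearMap.range (defect T).toLinearMap : Set H)
      (LinearMap.range (defect (adjoint T)).toLinearMap : Set H) := by
    rintro _ ⟨y, rfl⟩
    exact ⟨T y, congr($((mul_defect hT).symm) y)⟩
  exact hmaps.closure T.continuous hx

theorem adjoint_map_mem_defectSpace (hT : ‖T‖ ≤ 1) {x : H} (hx : x ∈ defectSpace (adjoint T)) :
    adjoint T x ∈ defectSpace T := by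
  have hT' : ‖adjoint T‖ ≤ 1 := by rwa [← star_eq_adjoint, norm_star]
  simpa using map_mem_defectSpace hT' hx

@[simp]
theorem coe_defectTo_apply (T : H →L[ℂ] H) (h : H) : (defectTo T h : H) = defect T h := rfl

theorem denseRange_defectTo (T : H →L[ℂ] H) : DenseRange (defectTo T) := by
  rw [DenseRange, Subtype.dense_iff]
  intro x hx
  refine closure_mono ?_ hx
  rintro _ ⟨y, rfl⟩
  exact ⟨_, ⟨y, rfl⟩, rfl⟩

theorem inner_defectTo_left (x : defectSpace T) (h : H) :
    inner ℂ (defectTo T h) x = inner ℂ h (defect T x) := by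
  rw [Submodule.coe_inner, coe_defectTo_apply, ← adjoint_inner_right, adjoint_defect]

/-- `D_T` is injective on its defect space. -/
theorem eq_zero_of_defect_apply_eq_zero {x : defectSpace T} (hx : defect T x = 0) : x = 0 :=
  (denseRange_defectTo T).eq_zero_of_inner_right ℂ (by
    intro h
    rw [inner_defectTo_left, hx, inner_zero_right])

/-! ### Existence and uniqueness of the fundamental operators -/

/-- Douglas' factorization: an operator dominated by an operator with dense range factors through
it. -/
theorem exists_comp_eq_of_norm_le {E F G : Type*} [NormedAddCommGroup E] [NormedSpace ℂ E]
    [NormedAddCommGroup F] [NormedSpace ℂ F] [NormedAddCommGroup G] [NormedSpace ℂ G]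
    [CompleteSpace F] {X : E →L[ℂ] F} {D : E →L[ℂ] G} (hD : DenseRange D) {C : ℝ}
    (hX : ∀ h, ‖X h‖ ≤ C * ‖D h‖) : ∃ Y : G →L[ℂ] F, ∀ h, Y (D h) = X h :=
  ⟨X.toLinearMap.extendOfNorm D.toLinearMap,
    LinearMap.extendOfNorm_eq (f := X.toLinearMap) (e := D.toLinearMap) hD ⟨C, hX⟩⟩

/-- Polarization of a bound for a quadratic form by a seminorm. -/
theorem norm_inner_le_of_quadratic {H : Type*} [NormedAddCommGroup H] [InnerProductSpace ℂ H]
    {X D : H →L[ℂ] H} {C : ℝ} (hC : 0 ≤ C)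
    (hX : ∀ h, ‖inner ℂ h (X h)‖ ≤ C * ‖D h‖ ^ 2) (g h : H) :
    ‖inner ℂ g (X h)‖ ≤ 2 * C * ‖D g‖ * ‖D h‖ := by
  -- The polarization identity and the parallelogram law give a sum in place of the product.
  have key : ∀ g h : H, ‖inner ℂ g (X h)‖ ≤ C * (‖D g‖ ^ 2 + ‖D h‖ ^ 2) := by
    intro g h
    have hpol : 4 * inner ℂ g (X h) = inner ℂ (h + g) (X (h + g)) - inner ℂ (h - g) (X (h - g)) -
        Complex.I * inner ℂ (h - Complex.I • g) (X (h - Complex.I • g)) +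
        Complex.I * inner ℂ (h + Complex.I • g) (X (h + Complex.I • g)) := by
      simp only [map_add, map_sub, map_smul, inner_add_left, inner_add_right, inner_sub_left,
        inner_sub_right, inner_smul_left, inner_smul_right, Complex.conj_I]
      linear_combination (2 * inner ℂ g (X h) - 2 * inner ℂ h (X g)) * Complex.I_sq
    have hpar : ∀ a b : H, ‖D (a + b)‖ ^ 2 + ‖D (a - b)‖ ^ 2 = 2 * (‖D a‖ ^ 2 + ‖D b‖ ^ 2) := by
      intro a b
      have := parallelogram_law_with_norm ℂ (D a) (D b)
      rw [map_add, map_sub]; linarith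
    have h4 : 4 * ‖inner ℂ g (X h)‖ ≤ C * ‖D (h + g)‖ ^ 2 + C * ‖D (h - g)‖ ^ 2 +
        C * ‖D (h - Complex.I • g)‖ ^ 2 + C * ‖D (h + Complex.I • g)‖ ^ 2 := by
      have : 4 * ‖inner ℂ g (X h)‖ = ‖4 * inner ℂ g (X h)‖ := by rw [norm_mul]; simp
      rw [this, hpol]
      refine (norm_add_le _ _).trans (add_le_add ((norm_sub_le _ _).trans (add_le_add
        ((norm_sub_le _ _).trans (add_le_add (hX _) (hX _))) ?_)) ?_) <;>
      · rw [norm_mul, Complex.norm_I, one_mul]; exact hX _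
    have hI : ‖D (Complex.I • g)‖ = ‖D g‖ := by rw [map_smul, norm_smul, Complex.norm_I, one_mul]
    have e1 := hpar h g
    have e2 := hpar h (Complex.I • g)
    rw [hI] at e2
    nlinarith
  -- Rescaling turns the sum into the product.
  have hscale : ∀ s t : ℝ, 0 < s → 0 < t →
      s * t * ‖inner ℂ g (X h)‖ ≤ C * (s ^ 2 * ‖D g‖ ^ 2 + t ^ 2 * ‖D h‖ ^ 2) := by
    intro s t hs ht
    have := key ((s : ℂ) • g) ((t : ℂ) • h)
    simpa [inner_smul_left, inner_smul_right, norm_smul, abs_of_pos hs, abs_of_pos ht, mul_pow,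
      mul_assoc, mul_left_comm t s] using this
  have hδ : ∀ δ : ℝ, 0 < δ → ‖inner ℂ g (X h)‖ ≤ 2 * C * (‖D g‖ + δ) * (‖D h‖ + δ) := by
    intro δ hδ
    have ha : 0 < ‖D g‖ + δ := by positivity
    have hb : 0 < ‖D h‖ + δ := by positivity
    refine le_of_mul_le_mul_left ((hscale _ _ hb ha).trans ?_) (mul_pos hb ha)
    calc C * ((‖D h‖ + δ) ^ 2 * ‖D g‖ ^ 2 + (‖D g‖ + δ) ^ 2 * ‖D h‖ ^ 2)
        ≤ C * ((‖D h‖ + δ) ^ 2 * (‖D g‖ + δ) ^ 2 + (‖D g‖ + δ) ^ 2 * (‖D h‖ + δ) ^ 2) := by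
          gcongr <;> linarith
      _ = (‖D h‖ + δ) * (‖D g‖ + δ) * (2 * C * (‖D g‖ + δ) * (‖D h‖ + δ)) := by ring
  have hcont : Continuous fun δ : ℝ => 2 * C * (‖D g‖ + δ) * (‖D h‖ + δ) := by fun_prop
  have hlim := (hcont.tendsto 0).mono_left (nhdsWithin_le_nhds (s := Set.Ioi 0))
  simp only [add_zero] at hlim
  exact ge_of_tendsto hlim (Filter.eventually_of_mem self_mem_nhdsWithin hδ)

/-- A quadratic form bounded by `‖D_T h‖²` factors through the defect operator. -/
theorem exists_eq_defect_comp {X : H →L[ℂ] H} {C : ℝ} (hC : 0 ≤ C)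
    (hX : ∀ h, ‖inner ℂ h (X h)‖ ≤ C * ‖defect T h‖ ^ 2) :
    ∃ F : defectSpace T →L[ℂ] defectSpace T,
      X = defect T ∘L (defectSpace T).subtypeL ∘L F ∘L defectTo T := by
  have hb := norm_inner_le_of_quadratic hC hX
  have hX' : ∀ h, ‖X h‖ ≤ 2 * C * ‖defect T‖ * ‖defectTo T h‖ := by
    intro h
    have h1 := hb (X h) h
    rw [inner_self_eq_norm_sq_to_K, norm_pow, RCLike.norm_ofReal, abs_norm] at h1
    by_cases h0 : ‖X h‖ = 0
    · rw [h0]; positivity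
    refine le_of_mul_le_mul_left ?_ (lt_of_le_of_ne (norm_nonneg _) (Ne.symm h0))
    calc ‖X h‖ * ‖X h‖ ≤ 2 * C * ‖defect T (X h)‖ * ‖defect T h‖ := by rwa [← sq]
      _ ≤ 2 * C * (‖defect T‖ * ‖X h‖) * ‖defect T h‖ := by gcongr; exact le_opNorm _ _
      _ = ‖X h‖ * (2 * C * ‖defect T‖ * ‖defectTo T h‖) := by
        rw [show ‖defectTo T h‖ = ‖defect T h‖ from rfl]; ring
  obtain ⟨Y, hY⟩ := exists_comp_eq_of_norm_le (denseRange_defectTo T) hX'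
  have hYb : ∀ g, ‖adjoint Y g‖ ≤ 2 * C * ‖defectTo T g‖ := by
    intro g
    have h1 : ∀ x, ‖inner ℂ (adjoint Y g) x‖ ≤ 2 * C * ‖defectTo T g‖ * ‖x‖ := by
      intro x
      refine (denseRange_defectTo T).induction_on x (isClosed_le (by fun_prop) (by fun_prop)) ?_
      intro h
      rw [adjoint_inner_left, hY]
      exact hb g h
    have h2 := h1 (adjoint Y g)
    rw [inner_self_eq_norm_sq_to_K, norm_pow, RCLike.norm_ofReal, abs_norm, sq] at h2
    by_cases h0 : ‖adjoint Y g‖ = 0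
    · rw [h0]; positivity
    exact le_of_mul_le_mul_right h2 (lt_of_le_of_ne (norm_nonneg _) (Ne.symm h0))
  obtain ⟨Z, hZ⟩ := exists_comp_eq_of_norm_le (denseRange_defectTo T) hYb
  refine ⟨adjoint Z, ?_⟩
  ext h
  refine ext_inner_left ℂ fun g => ?_
  have e1 : inner ℂ g (X h) = inner ℂ (Z (defectTo T g)) (defectTo T h) := by
    rw [hZ, adjoint_inner_left, hY]
  rw [e1, ← adjoint_inner_right, inner_defectTo_left]
  rfl

theorem IsFundamentalTuple.unique {m : ℕ} {S : Fin m → H →L[ℂ] H}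
    {F F' : Fin m → defectSpace T →L[ℂ] defectSpace T}
    (hF : IsFundamentalTuple S T F) (hF' : IsFundamentalTuple S T F') : F = F' := by
  funext i
  refine DFunLike.coe_injective ((denseRange_defectTo T).equalizer (F i).continuous
    (F' i).continuous (funext fun h => ?_))
  rw [Function.comp_apply, Function.comp_apply, ← sub_eq_zero]
  refine eq_zero_of_defect_apply_eq_zero ?_
  have := congr($((hF i).symm.trans (hF' i)) h)
  rw [Submodule.coe_sub, map_sub, sub_eq_zero]
  exact this

end Defect

section Fundamental

open ContinuousLinearMap

variable {H : Type*} [NormedAddCommGroup H] [InnerProductSpace ℂ H] [CompleteSpace H]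
  {m : ℕ} {S : Fin m → H →L[ℂ] H} {P : H →L[ℂ] H}

/-- Averaging the first family of inequalities over `w = ±1` removes its cross terms; adding the
second family then leaves only the cross terms of the latter. -/
theorem norm_inner_sub_inner_le {E : Type*} [NormedAddCommGroup E] [InnerProductSpace ℂ E]
    {k : ℝ} (hk : 0 < k) {g p a b : E}
    (h1 : ∀ w : ℂ, ‖w‖ ≤ 1 → ‖a - (w * k) • p‖ ≤ ‖(k : ℂ) • g - w • b‖)
    (h2 : ∀ w : ℂ, ‖w‖ ≤ 1 → ‖b - (w * k) • p‖ ≤ ‖(k : ℂ) • g - w • a‖) :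
    ‖(inner ℂ g a - inner ℂ b p : ℂ)‖ ≤ k * (‖g‖ ^ 2 - ‖p‖ ^ 2) := by
  have hkn : ∀ x : E, ‖(k : ℂ) • x‖ = k * ‖x‖ := fun x => by
    rw [norm_smul, Complex.norm_real, Real.norm_of_nonneg hk.le]
  have e1 : ‖a‖ ^ 2 + k ^ 2 * ‖p‖ ^ 2 ≤ k ^ 2 * ‖g‖ ^ 2 + ‖b‖ ^ 2 := by
    have i1 := pow_le_pow_left₀ (norm_nonneg _) (h1 1 (by simp)) 2
    have i2 := pow_le_pow_left₀ (norm_nonneg _) (h1 (-1) (by simp)) 2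
    simp only [one_mul, neg_mul, one_smul, neg_smul, sub_neg_eq_add] at i1 i2
    have p1 := parallelogram_law_with_norm ℂ a ((k : ℂ) • p)
    have p2 := parallelogram_law_with_norm ℂ ((k : ℂ) • g) b
    rw [hkn] at p1 p2
    nlinarith
  have e2 : ∀ w : ℂ, ‖w‖ = 1 →
      (w * (inner ℂ g a - inner ℂ b p)).re ≤ k * (‖g‖ ^ 2 - ‖p‖ ^ 2) := by
    intro w hw
    have i := pow_le_pow_left₀ (norm_nonneg _) (h2 w hw.le) 2
    rw [norm_sub_sq (𝕜 := ℂ), norm_sub_sq (𝕜 := ℂ), mul_smul, norm_smul, norm_smul w a, hw, hkn,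
      hkn, inner_smul_right, inner_smul_right, inner_smul_left, inner_smul_right,
      Complex.conj_ofReal, mul_left_comm w] at i
    simp only [RCLike.re_to_complex, Complex.re_ofReal_mul] at i
    rw [mul_sub, Complex.sub_re]
    nlinarith
  set c : ℂ := inner ℂ g a - inner ℂ b p
  by_cases hc : c = 0
  · have := e2 1 (by simp)
    simpa [hc] using this
  · have hc' : ‖c‖ ≠ 0 := norm_ne_zero_iff.2 hc
    have := e2 (star c / ‖c‖) (by simp [hc'])
    rwa [div_mul_eq_mul_div, ← starRingEnd_apply, Complex.conj_mul', sq, mul_div_assoc,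
      div_self (by exact_mod_cast hc'), mul_one, Complex.ofReal_re] at this

theorem IsGammaContraction.norm_adjoint_sub_apply_le_of_norm_le_one (h : IsGammaContraction S P)
    (i : Fin m) {w : ℂ} (hw : ‖w‖ ≤ 1) (g : H) :
    ‖adjoint (S i) g - (w * ((m + 1).choose (i.val + 1) : ℝ)) • adjoint P g‖ ≤
      ‖(((m + 1).choose (i.val + 1) : ℝ) : ℂ) • g - w • adjoint (S i.rev) g‖ := by
  have hclosed : IsClosed {w : ℂ |
      ‖adjoint (S i) g - (w * ((m + 1).choose (i.val + 1) : ℝ)) • adjoint P g‖ ≤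
        ‖(((m + 1).choose (i.val + 1) : ℝ) : ℂ) • g - w • adjoint (S i.rev) g‖} :=
    isClosed_le (by fun_prop) (by fun_prop)
  have hsub : Metric.ball (0 : ℂ) 1 ⊆ {w : ℂ |
      ‖adjoint (S i) g - (w * ((m + 1).choose (i.val + 1) : ℝ)) • adjoint P g‖ ≤
        ‖(((m + 1).choose (i.val + 1) : ℝ) : ℂ) • g - w • adjoint (S i.rev) g‖} := by
    intro w hw
    rw [mem_ball_zero_iff] at hw
    have := h.norm_adjoint_sub_apply_le i (w := star w) (by rwa [norm_star]) g
    simpa [← star_eq_adjoint, star_smul] using this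
  have hmem := closure_minimal hsub hclosed
  rw [closure_ball _ one_ne_zero] at hmem
  exact hmem (mem_closedBall_zero_iff.2 hw)

/-- The quadratic form of `S_i^* - S_{n-i} P^*` is dominated by that of `D_{P^*}²`. -/
theorem IsGammaContraction.norm_inner_adjoint_sub_le (h : IsGammaContraction S P) (i : Fin m)
    (g : H) :
    ‖inner ℂ g ((adjoint (S i) - S i.rev * adjoint P) g)‖ ≤
      (m + 1).choose (i.val + 1) * ‖defect (adjoint P) g‖ ^ 2 := by
  have hP' : ‖adjoint P‖ ≤ 1 := by rw [← star_eq_adjoint, norm_star]; exact h.norm_P_le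
  have hrev : (m + 1).choose (i.rev.val + 1) = (m + 1).choose (i.val + 1) := by
    rw [← Nat.choose_symm_of_eq_add (n := m + 1)]
    rw [Fin.val_rev]; omega
  have h1 := fun (w : ℂ) (hw : ‖w‖ ≤ 1) => h.norm_adjoint_sub_apply_le_of_norm_le_one i hw g
  have h2 := fun (w : ℂ) (hw : ‖w‖ ≤ 1) => h.norm_adjoint_sub_apply_le_of_norm_le_one i.rev hw g
  rw [Fin.rev_rev, hrev] at h2
  have := norm_inner_sub_inner_le (by exact_mod_cast Nat.choose_pos (by omega)) h1 h2
  rw [norm_defect_apply_sq hP']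
  rw [adjoint_inner_left] at this
  rwa [sub_apply, inner_sub_right]

theorem IsGammaContraction.exists_isFundamentalTuple (h : IsGammaContraction S P) :
    ∃ B, IsFundamentalTuple (fun i => adjoint (S i)) (adjoint P) B := by
  choose B hB using fun i =>
    exists_eq_defect_comp (Nat.cast_nonneg _) (h.norm_inner_adjoint_sub_le i)
  refine ⟨B, fun i => ?_⟩
  rw [← hB, adjoint_adjoint]

end Fundamental

/-! ### The Hardy space: adjoints and coefficients -/

section HardySpace

variable {E : Type*} [NormedAddCommGroup E] [InnerProductSpace ℂ E]

theorem memℓp_two_of_hasSum {E : Type*} [NormedAddCommGroup E] {a : ℕ → E} {c : ℝ}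
    (h : HasSum (fun k => ‖a k‖ ^ 2) c) :
    Memℓp a 2 :=
  memℓp_gen (by simpa using h.summable)

theorem hasSum_norm_sq (f : Hardy E) : HasSum (fun k => ‖f k‖ ^ 2) (‖f‖ ^ 2) := by
  simpa using lp.hasSum_norm (p := 2) (by norm_num) f

theorem inner_hardyMap_left [CompleteSpace E] (B : E →L[ℂ] E) (f g : Hardy E) :
    inner ℂ (hardyMap B f) g = inner ℂ f (hardyMap (ContinuousLinearMap.adjoint B) g) := by
  rw [lp.inner_eq_tsum, lp.inner_eq_tsum]
  exact tsum_congr fun k => (ContinuousLinearMap.adjoint_inner_right _ _ _).symm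

/-- The adjoint of the shift is the backward shift. -/
theorem inner_hardyShift_left {f g g' : Hardy E} (h : ∀ k, g (k + 1) = g' k) :
    inner ℂ (hardyShift f) g = inner ℂ f g' := by
  refine (lp.hasSum_inner (hardyShift f) g).unique ?_
  rw [← hasSum_nat_add_iff' 1]
  have h0 : hardyShift f 0 = 0 := rfl
  have h1 : ∀ k, hardyShift f (k + 1) = f k := fun _ => rfl
  simpa [h, h0, h1] using lp.hasSum_inner f g'

theorem inner_hardyMap_add_hardyShift_left [CompleteSpace E] (B C : E →L[ℂ] E) {f g g' : Hardy E}
    (h : ∀ k, g (k + 1) = g' k) :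
    inner ℂ ((hardyMap (ContinuousLinearMap.adjoint B) + hardyShift ∘L hardyMap C) f) g =
      inner ℂ f (hardyMap B g + hardyMap (ContinuousLinearMap.adjoint C) g') := by
  rw [add_apply, ContinuousLinearMap.comp_apply, inner_add_left, inner_hardyShift_left h,
    inner_hardyMap_left, inner_hardyMap_left, ContinuousLinearMap.adjoint_adjoint, inner_add_right]

/-- The coefficients are determined by the values on the disc. -/
theorem eq_of_hardyEval_eq [CompleteSpace E] {f g : Hardy E}
    (h : ∀ z : ℂ, ‖z‖ < 1 → hardyEval f z = hardyEval g z) : f = g := by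
  have key : ∀ f : Hardy E, HasFPowerSeriesAt (hardyEval f)
      (fun n => ContinuousMultilinearMap.mkPiRing ℂ (Fin n) (f n)) 0 := by
    intro f
    refine hasFPowerSeriesAt_iff.2 ?_
    filter_upwards [Metric.ball_mem_nhds (0 : ℂ) one_pos] with z hz
    rw [mem_ball_zero_iff] at hz
    simpa [FormalMultilinearSeries.coeff, hardyEval] using (summable_hardyEval f hz).hasSum
  have heq := (key f).eq_formalMultilinearSeries ((key g).congr (by
    filter_upwards [Metric.ball_mem_nhds (0 : ℂ) one_pos] with z hz
    exact (h z (mem_ball_zero_iff.1 hz)).symm))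
  ext n
  simpa using congr($(congrFun heq n) 1)

end HardySpace

/-! ### The range of the characteristic function through a state recursion -/

section Model

open ContinuousLinearMap

variable {H : Type*} [NormedAddCommGroup H] [InnerProductSpace ℂ H] [CompleteSpace H]
  {P : H →L[ℂ] H}

/-- The operator matrix with rows `(P^*, D_P)` and `(D_{P^*}, -P)` is isometric. -/
theorem norm_sq_add_norm_sq_colligation (hP : ‖P‖ ≤ 1) (u f : H) :
    ‖adjoint P u + defect P f‖ ^ 2 + ‖defect (adjoint P) u - P f‖ ^ 2 = ‖u‖ ^ 2 + ‖f‖ ^ 2 := by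
  have hP' : ‖adjoint P‖ ≤ 1 := by rwa [← star_eq_adjoint, norm_star]
  have h1 : inner ℂ (adjoint P u) (defect P f) = inner ℂ (defect (adjoint P) u) (P f) := by
    rw [adjoint_inner_left, ← adjoint_inner_right, adjoint_defect]
    exact congr(inner ℂ u ($(mul_defect hP) f))
  rw [norm_add_sq (𝕜 := ℂ), norm_sub_sq (𝕜 := ℂ), h1, norm_defect_apply_sq hP,
    norm_defect_apply_sq hP']
  ring

/-- The system with input `f`, state `u` and output `g` whose transfer function is `Θ_P`, started
at the state `0`. -/
structure IsTrajectory (P : H →L[ℂ] H) (f : ℕ → H) (u g : ℕ → H) : Prop where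
  zero : u 0 = 0
  succ : ∀ n, u (n + 1) = adjoint P (u n) + defect P (f n)
  out : ∀ n, g n = defect (adjoint P) (u n) - P (f n)

theorem exists_isTrajectory (P : H →L[ℂ] H) (f : ℕ → H) : ∃ u g, IsTrajectory P f u g :=
  let u : ℕ → H := fun n => Nat.rec 0 (fun n u => adjoint P u + defect P (f n)) n
  ⟨u, fun n => defect (adjoint P) (u n) - P (f n), rfl, fun _ => rfl, fun _ => rfl⟩

namespace IsTrajectory

variable {f u g : ℕ → H}

theorem energy (h : IsTrajectory P f u g) (hP : ‖P‖ ≤ 1) (N : ℕ) :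
    ‖u N‖ ^ 2 + ∑ n ∈ Finset.range N, ‖g n‖ ^ 2 = ∑ n ∈ Finset.range N, ‖f n‖ ^ 2 := by
  induction N with
  | zero => simp [h.zero]
  | succ N ih =>
    have := norm_sq_add_norm_sq_colligation hP (u N) (f N)
    rw [Finset.sum_range_succ, Finset.sum_range_succ, ← ih, h.succ, h.out]
    linarith

/-- The state is recovered from the next state and the output, since the operator matrix of the
system is unitary. -/
theorem state_eq (h : IsTrajectory P f u g) (hP : ‖P‖ ≤ 1) (n : ℕ) :
    u n = P (u (n + 1)) + defect (adjoint P) (g n) := by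
  have hP' : ‖adjoint P‖ ≤ 1 := by rwa [← star_eq_adjoint, norm_star]
  have h1 : P (defect P (f n)) = defect (adjoint P) (P (f n)) := congr($(mul_defect hP) (f n))
  rw [h.succ, h.out, map_add, map_sub, h1, defect_defect_apply hP', adjoint_adjoint]
  abel

theorem sum_pow_eq (h : IsTrajectory P f u g) (hP : ‖P‖ ≤ 1) (N : ℕ) :
    ∑ n ∈ Finset.range N, (P ^ n) (defect (adjoint P) (g n)) = -(P ^ N) (u N) := by
  induction N with
  | zero => simp [h.zero]
  | succ N ih =>
    have h1 : (P ^ (N + 1)) (u (N + 1)) = (P ^ N) (P (u (N + 1))) := by rw [pow_succ]; rfl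
    rw [Finset.sum_range_succ, ih, h.state_eq hP N, map_add, h1]
    abel

end IsTrajectory

theorem IsTrajectory.sum_norm_sq_le {f : Hardy (defectSpace P)} {u g : ℕ → H}
    (h : IsTrajectory P (fun n => (f n : H)) u g) (hP : ‖P‖ ≤ 1) (N : ℕ) :
    ‖u N‖ ^ 2 + ∑ n ∈ Finset.range N, ‖g n‖ ^ 2 ≤ ‖f‖ ^ 2 := by
  rw [h.energy hP]
  exact sum_le_hasSum _ (fun _ _ => by positivity) (hasSum_norm_sq f)

theorem IsTrajectory.norm_state_le {f : Hardy (defectSpace P)} {u g : ℕ → H}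
    (h : IsTrajectory P (fun n => (f n : H)) u g) (hP : ‖P‖ ≤ 1) (N : ℕ) : ‖u N‖ ≤ ‖f‖ := by
  refine le_of_sq_le_sq ?_ (norm_nonneg _)
  have := h.sum_norm_sq_le hP N
  have : 0 ≤ ∑ n ∈ Finset.range N, ‖g n‖ ^ 2 := Finset.sum_nonneg fun _ _ => by positivity
  linarith

theorem hasSum_coe_hardyEval {H : Type*} [NormedAddCommGroup H] [InnerProductSpace ℂ H]
    {K : Submodule ℂ H} [CompleteSpace K] (f : Hardy K) {z : ℂ}
    (hz : ‖z‖ < 1) : HasSum (fun k => z ^ k • (f k : H)) (hardyEval f z : K) := by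
  simpa [hardyEval] using (summable_hardyEval f hz).hasSum.mapL K.subtypeL

/-- The generating function of the output is `Θ_P` times that of the input. -/
theorem IsTrajectory.hardyEval_eq {f : Hardy (defectSpace P)} {u : ℕ → H}
    {g : Hardy (defectSpace (adjoint P))}
    (h : IsTrajectory P (fun n => (f n : H)) u fun n => (g n : H)) (hP : ‖P‖ ≤ 1) {z : ℂ}
    (hz : ‖z‖ < 1) :
    ((hardyEval g z : defectSpace (adjoint P)) : H) = charFun P z (hardyEval f z) := by
  have hu : Summable fun n => z ^ n • u n := by
    refine Summable.of_norm_bounded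
      ((summable_geometric_of_lt_one (norm_nonneg z) hz).mul_right ‖f‖) fun k => ?_
    rw [norm_smul, norm_pow]
    gcongr
    exact h.norm_state_le hP k
  have hF := hasSum_coe_hardyEval f hz
  obtain ⟨U, hU⟩ := hu
  have hstate : (1 - z • adjoint P) U = z • defect P (hardyEval f z : defectSpace P) := by
    have h1 : HasSum (fun n => z ^ (n + 1) • u (n + 1)) U := by
      simpa [h.zero] using (hasSum_nat_add_iff' 1).2 hU
    have h2 : HasSum (fun n => z ^ (n + 1) • u (n + 1))
        (z • (adjoint P U + defect P (hardyEval f z : defectSpace P))) := by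
      simpa [h.succ, smul_add, smul_smul, pow_succ'] using
        ((hU.mapL (adjoint P)).add (hF.mapL (defect P))).const_smul z
    have := h1.unique h2
    change U - z • adjoint P U = _
    nth_rw 1 [this]
    rw [smul_add, add_sub_cancel_left]
  have hunit : IsUnit (1 - z • adjoint P) := by
    refine isUnit_one_sub_of_norm_lt_one ?_
    rw [norm_smul, ← star_eq_adjoint, norm_star]
    exact (mul_le_of_le_one_right (norm_nonneg _) hP).trans_lt hz
  have hU' : U =
      z • Ring.inverse (1 - z • adjoint P) (defect P (hardyEval f z : defectSpace P)) := by
    have := congr($(Ring.inverse_mul_cancel _ hunit) U)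
    rw [← map_smul, ← hstate]
    exact this.symm
  have hG : HasSum (fun n => z ^ n • (g n : H))
      (defect (adjoint P) U - P (hardyEval f z : defectSpace P)) := by
    simpa [h.out, smul_sub] using (hU.mapL (defect (adjoint P))).sub (hF.mapL P)
  rw [(hasSum_coe_hardyEval g hz).unique hG, hU', map_smul]
  simp [charFun]
  abel

/-- The range of multiplication by `Θ_P` consists of the outputs of the system. -/
theorem mem_charRange_iff (hP : ‖P‖ ≤ 1) {g : Hardy (defectSpace (adjoint P))} :
    g ∈ charRange P ↔ ∃ (f : Hardy (defectSpace P)) (u : ℕ → H),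
      IsTrajectory P (fun n => (f n : H)) u fun n => (g n : H) := by
  constructor
  · rintro ⟨f, hf⟩
    obtain ⟨u, g', h⟩ := exists_isTrajectory P fun n => (f n : H)
    have hmem : ∀ n, g' n ∈ defectSpace (adjoint P) := fun n => by
      rw [h.out]
      exact Submodule.sub_mem _ (defectTo (adjoint P) (u n)).2 (map_mem_defectSpace hP (f n).2)
    have hsum : Summable fun n => ‖g' n‖ ^ 2 := by
      refine summable_of_sum_range_le (c := ‖f‖ ^ 2) (fun _ => by positivity) fun N => ?_
      have := h.sum_norm_sq_le hP N
      nlinarith [sq_nonneg ‖u N‖]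
    let G : Hardy (defectSpace (adjoint P)) :=
      ⟨fun n => ⟨g' n, hmem n⟩, memℓp_two_of_hasSum (by simpa using hsum.hasSum)⟩
    have hG : IsTrajectory P (fun n => (f n : H)) u fun n => (G n : H) := h
    have : g = G := eq_of_hardyEval_eq fun z hz => Subtype.ext <| by
      rw [hf z hz, hG.hardyEval_eq hP hz]
    exact ⟨f, u, this ▸ hG⟩
  · rintro ⟨f, u, h⟩
    exact ⟨f, fun z hz => h.hardyEval_eq hP hz⟩

/-! ### The canonical isometry onto the model space -/

theorem hasSum_norm_defectTo_sq (hP : ‖P‖ ≤ 1)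
    (hpure : ∀ h : H, Filter.Tendsto (fun k : ℕ => (adjoint P ^ k) h) Filter.atTop (nhds 0))
    (h : H) : HasSum (fun k => ‖defectTo (adjoint P) ((adjoint P ^ k) h)‖ ^ 2) (‖h‖ ^ 2) := by
  have hP' : ‖adjoint P‖ ≤ 1 := by rwa [← star_eq_adjoint, norm_star]
  rw [hasSum_iff_tendsto_nat_of_nonneg fun _ => by positivity]
  have hsum : ∀ N, ∑ k ∈ Finset.range N, ‖defectTo (adjoint P) ((adjoint P ^ k) h)‖ ^ 2 =
      ‖h‖ ^ 2 - ‖(adjoint P ^ N) h‖ ^ 2 := by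
    intro N
    induction N with
    | zero => simp
    | succ N ih =>
      rw [Finset.sum_range_succ, ih, Submodule.coe_norm, coe_defectTo_apply,
        norm_defect_apply_sq hP', pow_succ' (adjoint P)]
      change _ = _ - ‖adjoint P ((adjoint P ^ N) h)‖ ^ 2
      ring
  simp only [hsum]
  simpa using ((hpure h).norm.pow 2).const_sub (‖h‖ ^ 2)

/-- The isometry `h ↦ ∑ z^k D_{P^*} P^{*k} h` of a pure contraction into its Hardy space. -/
def modelEmbedding (hP : ‖P‖ ≤ 1)
    (hpure : ∀ h : H, Filter.Tendsto (fun k : ℕ => (adjoint P ^ k) h) Filter.atTop (nhds 0)) :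
    H →ₗᵢ[ℂ] Hardy (defectSpace (adjoint P)) where
  toFun h := ⟨fun k => defectTo (adjoint P) ((adjoint P ^ k) h),
    memℓp_two_of_hasSum (hasSum_norm_defectTo_sq hP hpure h)⟩
  map_add' g h := lp.ext <| funext fun k => by
    change defectTo (adjoint P) _ = defectTo (adjoint P) _ + defectTo (adjoint P) _
    rw [map_add, map_add]
  map_smul' c h := lp.ext <| funext fun k => by
    change defectTo (adjoint P) _ = c • defectTo (adjoint P) _
    rw [map_smul, map_smul]
  norm_map' h := by
    rw [← sq_eq_sq₀ (norm_nonneg _) (norm_nonneg _)]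
    exact (hasSum_norm_sq _).unique (hasSum_norm_defectTo_sq hP hpure h)

variable (hP : ‖P‖ ≤ 1)
  (hpure : ∀ h : H, Filter.Tendsto (fun k : ℕ => (adjoint P ^ k) h) Filter.atTop (nhds 0))

theorem modelEmbedding_apply (h : H) (k : ℕ) :
    modelEmbedding hP hpure h k = defectTo (adjoint P) ((adjoint P ^ k) h) := rfl

theorem modelEmbedding_succ (h : H) (k : ℕ) :
    modelEmbedding hP hpure h (k + 1) = modelEmbedding hP hpure (adjoint P h) k := by
  rw [modelEmbedding_apply, modelEmbedding_apply, pow_succ]; rfl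

/-- The range of `modelEmbedding` is orthogonal to that of multiplication by `Θ_P`: by
`IsTrajectory.sum_pow_eq`, the partial sums of the inner product are `-⟪u_N, P^{*N} h⟫`. They tend
to `0` as `P` is pure and the states are bounded. -/
theorem inner_modelEmbedding_eq_zero (h : H) {g : Hardy (defectSpace (adjoint P))}
    (hg : g ∈ charRange P) : inner ℂ g (modelEmbedding hP hpure h) = 0 := by
  obtain ⟨f, u, ht⟩ := (mem_charRange_iff hP).1 hg
  have h1 := (lp.hasSum_inner (𝕜 := ℂ) g (modelEmbedding hP hpure h)).tendsto_sum_nat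
  refine tendsto_nhds_unique h1 ?_
  have hpow : ∀ (k : ℕ) (x y : H), inner ℂ x ((adjoint P ^ k) y) = inner ℂ ((P ^ k) x) y := by
    intro k x y
    rw [← star_eq_adjoint, ← star_pow, star_eq_adjoint, adjoint_inner_right]
  have h2 : ∀ N, ∑ k ∈ Finset.range N, inner ℂ (g k) (modelEmbedding hP hpure h k) =
      -inner ℂ (u N) ((adjoint P ^ N) h) := by
    intro N
    rw [hpow, ← inner_neg_left, ← ht.sum_pow_eq hP, sum_inner]
    refine Finset.sum_congr rfl fun k _ => ?_
    rw [modelEmbedding_apply, Submodule.coe_inner, coe_defectTo_apply, ← hpow,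
      ← adjoint_inner_left, adjoint_defect]
  simp only [h2]
  rw [← neg_zero]
  refine Filter.Tendsto.neg (squeeze_zero_norm
    (a := fun N => ‖f‖ * ‖(adjoint P ^ N) h‖) (fun N => ?_) ?_)
  · exact (norm_inner_le_norm _ _).trans (by gcongr; exact ht.norm_state_le hP N)
  · simpa using (hpure h).norm.const_mul ‖f‖

/-- Running the unitary system backwards from the state `0` after time `n`, with the output
`z^n ⊗ ξ`, leads to an initial state `v 0` and an input; this splits `z^n ⊗ ξ` into the free
evolution of the initial state and a response to the input. -/
theorem single_sub_modelEmbedding_mem_charRange (n : ℕ) (ξ : defectSpace (adjoint P)) :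
    lp.single 2 n ξ - modelEmbedding hP hpure ((P ^ n) (defect (adjoint P) ξ)) ∈ charRange P := by
  have hP' : ‖adjoint P‖ ≤ 1 := by rwa [← star_eq_adjoint, norm_star]
  set g : Hardy (defectSpace (adjoint P)) := lp.single 2 n ξ with hg
  have hg_ne : ∀ k, k ≠ n → g k = 0 := fun k hk =>
    lp.single_apply_ne (E := fun _ => defectSpace (adjoint P)) 2 n ξ hk
  have hg_n : g n = ξ :=
    lp.single_apply_self (E := fun _ => defectSpace (adjoint P)) 2 n ξ
  set v : ℕ → H := fun k => if k ≤ n then (P ^ (n - k)) (defect (adjoint P) ξ) else 0 with hv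
  have hv_succ : ∀ k, v k = P (v (k + 1)) + defect (adjoint P) (g k) := by
    intro k
    rcases lt_trichotomy k n with hk | rfl | hk
    · have : n - k = (n - (k + 1)) + 1 := by omega
      simp only [hv, hk.le, Nat.succ_le_of_lt hk, if_true, hg_ne k hk.ne, this, pow_succ']
      simp
    · simp [hv, hg_n]
    · have h1 : ¬ k ≤ n := by omega
      have h2 : ¬ k + 1 ≤ n := by omega
      simp [hv, h1, h2, hg_ne k hk.ne']
  let F : ℕ → defectSpace P := fun k => defectTo P (v (k + 1)) -
    ⟨adjoint P (g k), adjoint_map_mem_defectSpace hP (g k).2⟩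
  have hF : ∀ k, (F k : H) = defect P (v (k + 1)) - adjoint P (g k) := fun _ => rfl
  have hF0 : ∀ k, n < k → F k = 0 := by
    intro k hk
    refine Subtype.ext ?_
    have : ¬ k + 1 ≤ n := by omega
    simp [hF, hv, this, hg_ne k hk.ne']
  let f : Hardy (defectSpace P) := ⟨F, memℓp_gen <| summable_of_ne_finset_zero
    (s := Finset.range (n + 1)) fun k hk => by
      rw [hF0 k (by simpa using hk)]; simp⟩
  have hv0 : v 0 = (P ^ n) (defect (adjoint P) ξ) := by simp [hv]
  rw [← hv0]
  have h1 : ∀ x, adjoint P (defect (adjoint P) x) = defect P (adjoint P x) := fun x => by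
    simpa using congr($(mul_defect hP') x)
  have h2 : ∀ x, P (defect P x) = defect (adjoint P) (P x) := fun x => congr($(mul_defect hP) x)
  refine (mem_charRange_iff hP).2 ⟨f, fun k => v k - (adjoint P ^ k) (v 0), by simp, ?_, ?_⟩
  · intro k
    change _ = _ + defect P (F k)
    rw [hF, map_sub, map_sub, defect_defect_apply hP, ← h1, hv_succ k, map_add, pow_succ']
    change _ - adjoint P ((adjoint P ^ k) (v 0)) = _
    abel
  · intro k
    change ((g k - modelEmbedding hP hpure (v 0) k : defectSpace (adjoint P)) : H) = _ - P (F k)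
    rw [hF, map_sub, map_sub, h2, hv_succ k, map_add, defect_defect_apply hP', adjoint_adjoint,
      Submodule.coe_sub, modelEmbedding_apply, coe_defectTo_apply]
    abel

theorem range_modelEmbedding :
    LinearMap.range (modelEmbedding hP hpure).toLinearMap = modelSpace P := by
  refine le_antisymm ?_ fun g hg => ?_
  · rintro _ ⟨h, rfl⟩
    exact (Submodule.mem_orthogonal _ _).2 fun g hg => inner_modelEmbedding_eq_zero hP hpure h hg
  · set W := modelEmbedding hP hpure
    -- The part of `g` orthogonal to the range of `W` is orthogonal to all `z^n ⊗ ξ`.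
    set h := adjoint W.toContinuousLinearMap g with hh
    refine ⟨h, ?_⟩
    change W h = g
    rw [eq_comm, ← sub_eq_zero]
    have hW : ∀ x, inner ℂ (W x) (g - W h) = 0 := by
      intro x
      have : inner ℂ (W x) g = inner ℂ x h := by
        rw [hh, adjoint_inner_right]; rfl
      rw [inner_sub_right, this, W.inner_map_map, sub_self]
    refine lp.ext (funext fun n => ext_inner_left ℂ fun ξ => ?_)
    have h1 : inner ℂ (lp.single 2 n ξ - W ((P ^ n) (defect (adjoint P) ξ))) (g - W h) = 0 := by
      have hm := single_sub_modelEmbedding_mem_charRange hP hpure n ξ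
      rw [inner_sub_right, (Submodule.mem_orthogonal _ _).1 hg _ hm,
        inner_modelEmbedding_eq_zero hP hpure h hm, sub_zero]
    rw [inner_sub_left, hW, sub_zero, lp.inner_single_left] at h1
    rw [h1]
    simp

/-- The unitary from `H` onto the model space given by `modelEmbedding`. -/
def modelEquiv : H ≃ₗᵢ[ℂ] modelSpace P :=
  (modelEmbedding hP hpure).equivRange.trans
    (LinearIsometryEquiv.ofEq _ _ (range_modelEmbedding hP hpure))

/-- If `T^* W = W A^*` for the canonical isometry `W`, then `T` compresses to `W A W^*`. -/
theorem modelEquiv_apply_eq_compression {A : H →L[ℂ] H}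
    {T : Hardy (defectSpace (adjoint P)) →L[ℂ] Hardy (defectSpace (adjoint P))}
    (hT : ∀ f g, inner ℂ (T f) (modelEmbedding hP hpure g) =
      inner ℂ f (modelEmbedding hP hpure (adjoint A g))) (h : H) :
    modelEquiv hP hpure (A h) = compression P T (modelEquiv hP hpure h) := by
  refine ext_inner_right ℂ fun y => ?_
  obtain ⟨g, rfl⟩ := (modelEquiv hP hpure).surjective y
  have h1 : inner ℂ (compression P T (modelEquiv hP hpure h)) (modelEquiv hP hpure g) =
      inner ℂ (T (modelEmbedding hP hpure h)) (modelEmbedding hP hpure g) :=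
    Submodule.inner_orthogonalProjectionOnto_eq_of_mem_right (modelEquiv hP hpure g) _
  exact ((LinearIsometryEquiv.inner_map_map _ _ _).trans (adjoint_inner_right A h g).symm).trans
    ((LinearIsometry.inner_map_map _ _ _).symm.trans ((hT _ g).symm.trans h1.symm))

/-! ### Intertwining relations -/

/-- The identity `D_{P^*} S_i^* = B_i D_{P^*} + B_{n-i}^* D_{P^*} P^*`. -/
theorem IsFundamentalTuple.defectTo_adjoint_apply {m : ℕ} {S : Fin m → H →L[ℂ] H}
    {B : Fin m → defectSpace (adjoint P) →L[ℂ] defectSpace (adjoint P)} (hP : ‖P‖ ≤ 1)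
    (hB : IsFundamentalTuple (fun i => adjoint (S i)) (adjoint P) B) {i : Fin m}
    (hSP : Commute (S i) P) (h : H) :
    defectTo (adjoint P) (adjoint (S i) h) = B i (defectTo (adjoint P) h) +
      adjoint (B i.rev) (defectTo (adjoint P) (adjoint P h)) := by
  have hP' : ‖adjoint P‖ ≤ 1 := by rwa [← star_eq_adjoint, norm_star]
  have hB' : ∀ j (x y : H), inner ℂ (defectTo (adjoint P) x) (B j (defectTo (adjoint P) y)) =
      inner ℂ x (adjoint (S j) y - S j.rev (adjoint P y)) := by
    intro j x y
    have := congr($(hB j) y)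
    rw [inner_defectTo_left]
    simp only [adjoint_adjoint] at this
    exact congr(inner ℂ x $this).symm
  have hcomm : adjoint (S i) (adjoint P h) = adjoint P (adjoint (S i) h) := by
    have := congr(star $(hSP.eq) h)
    simpa [star_mul, star_eq_adjoint] using this.symm
  refine (denseRange_defectTo (adjoint P)).eq_of_inner_right ℂ fun g => ?_
  rw [inner_add_right, adjoint_inner_right, hB', ← inner_conj_symm (B i.rev _), hB',
    inner_conj_symm, inner_defectTo_left, coe_defectTo_apply, defect_defect_apply hP',
    adjoint_adjoint, Fin.rev_rev, inner_sub_left, inner_sub_right, inner_sub_right,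
    adjoint_inner_left, ← adjoint_inner_right (S i), hcomm, adjoint_inner_left]
  ring

/-- The relation `(I ⊗ B_i^* + M_z ⊗ B_{n-i})^* W = W S_i^*`, with `M_z^* W` replaced by `W P^*`. -/
theorem IsFundamentalTuple.hardyMap_modelEmbedding_add {m : ℕ} {S : Fin m → H →L[ℂ] H}
    {B : Fin m → defectSpace (adjoint P) →L[ℂ] defectSpace (adjoint P)}
    (hB : IsFundamentalTuple (fun i => adjoint (S i)) (adjoint P) B) {i : Fin m}
    (hSP : Commute (S i) P) (g : H) :
    hardyMap (B i) (modelEmbedding hP hpure g) +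
      hardyMap (adjoint (B i.rev)) (modelEmbedding hP hpure (adjoint P g)) =
        modelEmbedding hP hpure (adjoint (S i) g) := by
  refine lp.ext (funext fun k => ?_)
  have hcomm : (adjoint P ^ k) (adjoint (S i) g) = adjoint (S i) ((adjoint P ^ k) g) :=
    congr($((hSP.star_star.pow_right k).eq.symm) g)
  have hcomm' : (adjoint P ^ k) (adjoint P g) = adjoint P ((adjoint P ^ k) g) :=
    congr($((Commute.self_pow (adjoint P) k).eq.symm) g)
  change B i (defectTo (adjoint P) ((adjoint P ^ k) g)) +
    adjoint (B i.rev) (defectTo (adjoint P) ((adjoint P ^ k) (adjoint P g))) =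
      defectTo (adjoint P) ((adjoint P ^ k) (adjoint (S i) g))
  rw [hcomm, hcomm', hB.defectTo_adjoint_apply hP hSP]

end Model

end GammaModel

end

theorem theorem3p12 (n : ℕ) (hn : 2 ≤ n)
    {H : Type*} [NormedAddCommGroup H] [InnerProductSpace ℂ H] [CompleteSpace H]
    (S : Fin (n - 1) → H →L[ℂ] H) (P : H →L[ℂ] H)
    (hSP : GammaModel.IsPureGammaContraction S P) :
    ∃ B : Fin (n - 1) →
        GammaModel.defectSpace (ContinuousLinearMap.adjoint P) →L[ℂ]
          GammaModel.defectSpace (ContinuousLinearMap.adjoint P),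
      GammaModel.IsFundamentalTuple (fun i => ContinuousLinearMap.adjoint (S i))
        (ContinuousLinearMap.adjoint P) B ∧
      (∀ B', GammaModel.IsFundamentalTuple (fun i => ContinuousLinearMap.adjoint (S i))
        (ContinuousLinearMap.adjoint P) B' → B' = B) ∧
      ∃ U : H ≃ₗᵢ[ℂ] GammaModel.modelSpace P,
        (∀ i h, U (S i h) =
          GammaModel.compression P
            (GammaModel.hardyMap (ContinuousLinearMap.adjoint (B i)) +
              GammaModel.hardyShift ∘L GammaModel.hardyMap (B i.rev)) (U h)) ∧
        ∀ h, U (P h) = GammaModel.compression P GammaModel.hardyShift (U h) := by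
  have hP := hSP.norm_P_le
  obtain ⟨B, hB⟩ := hSP.toIsGammaContraction.exists_isFundamentalTuple
  refine ⟨B, hB, fun B' hB' => hB'.unique hB, GammaModel.modelEquiv hP hSP.pure, fun i h => ?_,
    fun h => ?_⟩
  · refine GammaModel.modelEquiv_apply_eq_compression hP hSP.pure (fun f g => ?_) h
    exact (GammaModel.inner_hardyMap_add_hardyShift_left (B i) (B i.rev)
      (GammaModel.modelEmbedding_succ hP hSP.pure g)).trans
      (congrArg _ (hB.hardyMap_modelEmbedding_add hP hSP.pure (hSP.commute_P i) g))
  · exact GammaModel.modelEquiv_apply_eq_compression hP hSP.pure (fun f g =>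
      GammaModel.inner_hardyShift_left (GammaModel.modelEmbedding_succ hP hSP.pure g)) h
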